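/- Let $k$ be an algebraically closed field of any characteristic and let $x_1,\dots,x_r$ be variables. A \emph{basis set} is a finite nonempty set $\beta$ of monomials in $x_1,\dots,x_r$ that contains every divisor of each of its members; put $n=|\beta|$. The monomials not in $\beta$ generate a monomial ideal $I_\beta\subseteq k[x_1,\dots,x_r]$ of colength $n$, which corresponds to a point $t_\beta$ of the Hilbert scheme $\mathrm{Hilb}^n_{\mathbb A^r_k}$; this point lies in the affine open subscheme $U_\beta$ that parametrizes the ideals $I$ for which $\beta$ is a basis of the quotient by $I$. The basis set $\beta$ is called \emph{smooth} if $t_\beta$ is a nonsingular point, i.e. its local ring is regular. For positive integers $w_1,\dots,w_r$ let $$\mathrm{Box}(w_1,\dots,w_r)=\{x_1^{d_1}\cdots x_r^{d_r} : 0\le d_i<w_i,\ 1\le i\le r\}.$$ The $x_i$-width of a basis set $\beta$ is the least $w$ with $x_i^{w}\notin\beta$. A set $\beta'$ is obtained from a basis set $\beta$ with widths $w_1,\dots,w_r$ by \emph{adding a box} in the $x_j$-direction if $\beta'=(x_j^h\cdot\beta)\cup \mathrm{Box}(w_1',\dots,w_{j-1}',h,w_{j+1}',\dots,w_r')$ for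 some $h\ge 1$ and some integers $w_i'\ge w_i$ ($i\ne j$). A \emph{compound box} is a set obtained from a box by finitely many (possibly zero) box additions. (1) For every $r$ and any two boxes $\mathrm{Box}_1,\mathrm{Box}_2$ in $r$ variables, $\beta=\mathrm{Box}_1\cup\mathrm{Box}_2$ is a smooth basis set, and the cotangent space $M/M^2$ of $t_\beta$, where $M$ is the maximal ideal of $t_\beta$ in the coordinate ring of $U_\beta$, has $k$-dimension $r\,|\beta|$. (2) For every $r\ge 4$ there are two boxes in $r$ variables whose union is not a compound box. In particular, for $r=4$, the set $$\{1,\ x_1,\ x_2,\ x_1x_2,\ x_3,\ x_4,\ x_3x_4\}=\mathrm{Box}(2,2,1,1)\cup\mathrm{Box}(1,1,2,2)$$ is not a compound box. -/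

import Mathlib

/-!
Monomials in the variables `x_1, …, x_r` are represented by their exponent vectors `Fin r → ℕ`
(so `x_i` has index `i - 1`), and divisibility of monomials is the componentwise order.
-/

namespace HilbPoints

/-- A basis set: a finite nonempty set of monomials closed under taking divisors. -/
def IsBasisSet {r : ℕ} (β : Finset (Fin r → ℕ)) : Prop :=
  β.Nonempty ∧ ∀ d ∈ β, ∀ e, e ≤ d → e ∈ β

/-- `Box(w_1, …, w_r)`: all monomials whose `x_i`-degree is less than `w_i` for every `i`. -/
def box {r : ℕ} (w : Fin r → ℕ) : Finset (Fin r → ℕ) :=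
  Fintype.piFinset fun i => Finset.range (w i)

/-- The `x_i`-width of `β`: the least exponent `w` such that `x_i ^ w` is not in `β`. -/
noncomputable def width {r : ℕ} (β : Finset (Fin r → ℕ)) (i : Fin r) : ℕ :=
  sInf {w : ℕ | (Pi.single i w : Fin r → ℕ) ∉ β}

/-- `β'` is obtained by adding a box to `β` in the `x_j`-direction: for some `h ≥ 1` and some
`w'_k ≥ x_k`-width of `β` (`k ≠ j`), `β'` is the union of `x_j ^ h · β` and the box with
sides `w'_k` (`k ≠ j`) and `h` (in direction `j`). -/
def IsBoxAddition {r : ℕ} (j : Fin r) (β β' : Finset (Fin r → ℕ)) : Prop :=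
  ∃ (h : ℕ) (w' : Fin r → ℕ), 1 ≤ h ∧ (∀ k, k ≠ j → width β k ≤ w' k) ∧
    β' = β.image (fun m => Pi.single j h + m) ∪ box (Function.update w' j h)

/-- Compound boxes: obtained from a box by finitely many box additions. -/
inductive IsCompoundBox {r : ℕ} : Finset (Fin r → ℕ) → Prop
  | box (w : Fin r → ℕ) (hw : ∀ i, 0 < w i) : IsCompoundBox (box w)
  | add (j : Fin r) (β β' : Finset (Fin r → ℕ)) (hβ : IsCompoundBox β)
      (hadd : IsBoxAddition j β β') : IsCompoundBox β'

/-! ### The affine open neighbourhood `U_β` of `t_β` in the Hilbert scheme of points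

`U_β` parametrizes the ideals `I` such that the monomials in `β` are a basis of the quotient
by `I`.  Its coordinate ring is generated by the coefficients `c^d_j` (`d ∉ β`, `j ∈ β`) of the
congruences `x^d ≡ ∑ j ∈ β, c^d_j x^j`. -/

/-- The arrows of `β`: pairs of a tail `d ∉ β` and a head `j ∈ β`. -/
abbrev Arrow {r : ℕ} (β : Finset (Fin r → ℕ)) : Type :=
  {d : Fin r → ℕ // d ∉ β} × {j : Fin r → ℕ // j ∈ β}

open Classical in
/-- The polynomial `C^b_j`: an indeterminate if `b ∉ β`, and the constant `δ_{bj}` if `b ∈ β`. -/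
noncomputable def coeffPoly (k : Type*) [CommRing k] {r : ℕ} (β : Finset (Fin r → ℕ))
    (b : Fin r → ℕ) (j : {j : Fin r → ℕ // j ∈ β}) : MvPolynomial (Arrow β) k :=
  if h : b ∈ β then (if b = j.1 then 1 else 0) else MvPolynomial.X (⟨b, h⟩, j)

/-- The relation `C^{d'}_{j₀} - ∑_j C^d_j C^{j'}_{j₀}` where the prime denotes multiplication of a
monomial by `x_i`. -/
noncomputable def rel (k : Type*) [CommRing k] {r : ℕ} (β : Finset (Fin r → ℕ))
    (d : Fin r → ℕ) (i : Fin r) (j₀ : {j : Fin r → ℕ // j ∈ β}) : MvPolynomial (Arrow β) k :=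
  coeffPoly k β (d + Pi.single i 1) j₀ -
    ∑ j : {j : Fin r → ℕ // j ∈ β},
      coeffPoly k β d j * coeffPoly k β (j.1 + Pi.single i 1) j₀

/-- The ideal generated by all the relations. -/
noncomputable def relIdeal (k : Type*) [CommRing k] {r : ℕ} (β : Finset (Fin r → ℕ)) :
    Ideal (MvPolynomial (Arrow β) k) :=
  Ideal.span {p | ∃ d i j₀, d ∉ β ∧ p = rel k β d i j₀}

/-- The coordinate ring of `U_β`. -/
abbrev CoordRing (k : Type*) [CommRing k] {r : ℕ} (β : Finset (Fin r → ℕ)) : Type _ :=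
  MvPolynomial (Arrow β) k ⧸ relIdeal k β

/-- The coefficient function `c^b_j` on `U_β`. -/
noncomputable def coeffFun (k : Type*) [CommRing k] {r : ℕ} (β : Finset (Fin r → ℕ))
    (b : Fin r → ℕ) (j : {j : Fin r → ℕ // j ∈ β}) : CoordRing k β :=
  Ideal.Quotient.mk (relIdeal k β) (coeffPoly k β b j)

/-- The ideal `M` of the point `t_β`, the origin of `U_β`: it is generated by the `c^d_j` with
`d ∉ β`. -/
noncomputable def originIdeal (k : Type*) [CommRing k] {r : ℕ} (β : Finset (Fin r → ℕ)) :
    Ideal (CoordRing k β) :=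
  Ideal.span {c | ∃ d j, d ∉ β ∧ c = coeffFun k β d j}

section Origin

variable {k : Type*} [CommRing k] {r : ℕ} {β : Finset (Fin r → ℕ)}

lemma add_single_notMem (hβ : IsBasisSet β) {d : Fin r → ℕ} (hd : d ∉ β) (e : Fin r → ℕ) :
    d + e ∉ β := fun h => hd (hβ.2 _ h _ (by intro i; simp))

lemma aeval_zero_coeffPoly {b : Fin r → ℕ} (hb : b ∉ β) (j : {j : Fin r → ℕ // j ∈ β}) :
    MvPolynomial.aeval (fun _ : Arrow β => (0 : k)) (coeffPoly k β b j) = 0 := by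
  simp [coeffPoly, hb]

/-- Evaluation at the origin `t_β`. -/
noncomputable def originHom (hβ : IsBasisSet β) : CoordRing k β →ₐ[k] k :=
  Ideal.Quotient.liftₐ (relIdeal k β) (MvPolynomial.aeval fun _ => (0 : k)) (by
    intro a ha
    rw [relIdeal] at ha
    have : Ideal.span {p | ∃ d i j₀, d ∉ β ∧ p = rel k β d i j₀} ≤
        RingHom.ker (MvPolynomial.aeval (fun _ : Arrow β => (0 : k))) := by
      rw [Ideal.span_le]
      rintro p ⟨d, i, j₀, hd, rfl⟩
      simp only [SetLike.mem_coe, RingHom.mem_ker, rel, map_sub, map_sum, map_mul]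
      rw [aeval_zero_coeffPoly (add_single_notMem hβ hd _)]
      simp [aeval_zero_coeffPoly hd]
    exact this ha)

lemma ker_originHom (hβ : IsBasisSet β) :
    RingHom.ker (originHom (k := k) hβ) = originIdeal k β := by
  apply le_antisymm
  · intro x hx
    obtain ⟨p, rfl⟩ := Ideal.Quotient.mk_surjective x
    have hp : MvPolynomial.aeval (fun _ : Arrow β => (0 : k)) p = 0 := hx
    have hp' : p ∈ Ideal.span
        ((MvPolynomial.X : Arrow β → MvPolynomial (Arrow β) k) '' Set.univ) := by
      rw [MvPolynomial.mem_ideal_span_X_image]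
      intro m hm
      by_contra! hcon
      have hm0 : m = 0 := by ext a; exact hcon a (Set.mem_univ a)
      rw [MvPolynomial.mem_support_iff, hm0] at hm
      apply hm
      simpa [MvPolynomial.aeval_zero', MvPolynomial.constantCoeff_eq] using hp
    have h2 := Ideal.mem_map_of_mem (Ideal.Quotient.mk (relIdeal k β)) hp'
    rw [Ideal.map_span] at h2
    refine Ideal.span_mono ?_ h2
    rintro _ ⟨_, ⟨⟨d, j⟩, -, rfl⟩, rfl⟩
    exact ⟨d.1, j, d.2, by simp [coeffFun, coeffPoly, d.2]⟩
  · rw [originIdeal, Ideal.span_le]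
    rintro _ ⟨d, j, hd, rfl⟩
    exact aeval_zero_coeffPoly hd j

lemma originIdeal_isPrime [IsDomain k] (hβ : IsBasisSet β) : (originIdeal k β).IsPrime := by
  rw [← ker_originHom hβ]
  exact RingHom.ker_isPrime _

end Origin

/-! ### The functor represented by `CoordRing k β`

The ring constructed above is the coordinate ring of `U_β`: its `A`-valued points are
the ideals `I` of `A[x_1, …, x_r]` such that `β` is an `A`-basis of the quotient by `I`; and the
origin corresponds to the monomial ideal `I_β` generated by the monomials that are not in `β`. -/

section Universal

open MvPolynomial

/-- The monomial `x^d`. -/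
noncomputable def mono (A : Type*) [CommRing A] {r : ℕ} (d : Fin r → ℕ) : MvPolynomial (Fin r) A :=
  monomial (Finsupp.equivFunOnFinite.symm d) 1

/-- The monomials in `β` are an `A`-basis of the quotient of `A[x_1, …, x_r]` by `I`. -/
def IsBasisOfQuotient {A : Type*} [CommRing A] {r : ℕ} (β : Finset (Fin r → ℕ))
    (I : Ideal (MvPolynomial (Fin r) A)) : Prop :=
  LinearIndependent A
      (fun j : {j : Fin r → ℕ // j ∈ β} => (Ideal.Quotient.mkₐ A I) (mono A j.1)) ∧
    ⊤ ≤ Submodule.span A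
      (Set.range fun j : {j : Fin r → ℕ // j ∈ β} => (Ideal.Quotient.mkₐ A I) (mono A j.1))

variable {k : Type*} [CommRing k] {r : ℕ} {β : Finset (Fin r → ℕ)}
  {A : Type*} [CommRing A] [Algebra k A]

/-- The polynomial `F_d = x^d - ∑ j ∈ β, c^d_j x^j` at the point `φ` of `U_β`. -/
noncomputable def univPoly (φ : CoordRing k β →ₐ[k] A) (d : Fin r → ℕ) : MvPolynomial (Fin r) A :=
  mono A d - ∑ j : {j : Fin r → ℕ // j ∈ β}, φ (coeffFun k β d j) • mono A j.1

lemma mono_add_single (d : Fin r → ℕ) (i : Fin r) :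
    mono A (d + Pi.single i 1) = X i * mono A d := by
  have : Finsupp.equivFunOnFinite.symm (d + Pi.single i 1) =
      Finsupp.single i 1 + Finsupp.equivFunOnFinite.symm d := by
    ext a
    simp [add_comm, Finsupp.single_apply, Pi.single_apply, eq_comm]
  rw [mono, this, X, mono, monomial_mul, one_mul]

lemma coeffPoly_mem {b : Fin r → ℕ} (hb : b ∈ β) (j : {j : Fin r → ℕ // j ∈ β}) :
    coeffPoly k β b j = if b = j.1 then 1 else 0 := by
  simp [coeffPoly, hb]

lemma coeffFun_mem {b : Fin r → ℕ} (hb : b ∈ β) (j : {j : Fin r → ℕ // j ∈ β}) :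
    coeffFun k β b j = if b = j.1 then 1 else 0 := by
  rw [coeffFun, coeffPoly_mem hb]
  split_ifs <;> simp

lemma coeffFun_add_single (d : Fin r → ℕ) (i : Fin r) (j₀ : {j : Fin r → ℕ // j ∈ β}) :
    coeffFun k β (d + Pi.single i 1) j₀ =
      ∑ j : {j : Fin r → ℕ // j ∈ β},
        coeffFun k β d j * coeffFun k β (j.1 + Pi.single i 1) j₀ := by
  by_cases hd : d ∈ β
  · rw [Finset.sum_eq_single (⟨d, hd⟩ : {j : Fin r → ℕ // j ∈ β})]
    · simp [coeffFun_mem hd]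
    · intro b _ hb
      rw [coeffFun_mem hd, if_neg, zero_mul]
      rintro rfl
      exact hb rfl
    · simp
  · have h : Ideal.Quotient.mk (relIdeal k β) (rel k β d i j₀) = 0 :=
      Ideal.Quotient.eq_zero_iff_mem.2 (Ideal.subset_span ⟨d, i, j₀, hd, rfl⟩)
    rw [rel, map_sub, sub_eq_zero, map_sum] at h
    simpa [coeffFun] using h

/-- Every ideal with quotient based on `β` is given by a unique point of `U_β`. -/
theorem existsUnique_point (I : Ideal (MvPolynomial (Fin r) A)) (hI : IsBasisOfQuotient β I) :
    ∃! φ : CoordRing k β →ₐ[k] A, ∀ d, univPoly φ d ∈ I := by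
  classical
  let b := Module.Basis.mk hI.1 hI.2
  have hb : ∀ j, b j = Ideal.Quotient.mkₐ A I (mono A j.1) := fun j => by simp [b]
  let c : (Fin r → ℕ) → {j : Fin r → ℕ // j ∈ β} → A :=
    fun d j => b.repr (Ideal.Quotient.mkₐ A I (mono A d)) j
  have hc : ∀ d, Ideal.Quotient.mkₐ A I (mono A d) = ∑ j, c d j • b j :=
    fun d => (b.sum_repr _).symm
  have hcm : ∀ d (hd : d ∈ β) j, c d j = if d = j.1 then 1 else 0 := by
    intro d hd j
    simp only [c]
    rw [← hb ⟨d, hd⟩, b.repr_self, Finsupp.single_apply]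
    simp [Subtype.ext_iff]
  have hev : ∀ d j, aeval (fun a : Arrow β => c a.1.1 a.2) (coeffPoly k β d j) = c d j := by
    intro d j
    by_cases hd : d ∈ β
    · rw [coeffPoly_mem hd, hcm d hd]
      split_ifs <;> simp
    · simp [coeffPoly, hd]
  have hrel : ∀ d i j₀, c (d + Pi.single i 1) j₀ = ∑ j, c d j * c (j.1 + Pi.single i 1) j₀ := by
    intro d i j₀
    have h1 : Ideal.Quotient.mkₐ A I (mono A (d + Pi.single i 1)) =
        ∑ j, c d j • Ideal.Quotient.mkₐ A I (mono A (j.1 + Pi.single i 1)) := by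
      rw [mono_add_single, map_mul, hc d, Finset.mul_sum]
      refine Finset.sum_congr rfl fun j _ => ?_
      rw [mono_add_single, map_mul, hb, mul_smul_comm]
    simp only [c] at h1 ⊢
    conv_lhs => rw [h1]
    simp [map_sum, Finsupp.finsetSum_apply]
  let φ : CoordRing k β →ₐ[k] A :=
    Ideal.Quotient.liftₐ (relIdeal k β) (aeval fun a : Arrow β => c a.1.1 a.2) (by
      have : relIdeal k β ≤ RingHom.ker (aeval (R := k) fun a : Arrow β => c a.1.1 a.2) := by
        rw [relIdeal, Ideal.span_le]
        rintro p ⟨d, i, j₀, hd, rfl⟩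
        simp only [SetLike.mem_coe, RingHom.mem_ker, rel, map_sub, map_sum, map_mul, hev]
        rw [hrel, sub_self]
      exact fun a ha => this ha)
  have hφ : ∀ d j, φ (coeffFun k β d j) = c d j := fun d j => hev d j
  refine ⟨φ, ?_, ?_⟩
  · intro d
    rw [← Ideal.Quotient.eq_zero_iff_mem]
    change Ideal.Quotient.mkₐ A I (univPoly φ d) = 0
    simp only [univPoly, hφ, map_sub, map_sum, map_smul, ← hb]
    rw [hc d, sub_self]
  · intro ψ hψ
    have hψc : ∀ d j, ψ (coeffFun k β d j) = c d j := by
      intro d j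
      have h : Ideal.Quotient.mkₐ A I (univPoly ψ d) = 0 :=
        Ideal.Quotient.eq_zero_iff_mem.2 (hψ d)
      simp only [univPoly, map_sub, map_sum, map_smul, ← hb, sub_eq_zero] at h
      simp only [c, h]
      rw [b.repr_sum_self]
    apply Ideal.Quotient.algHom_ext
    apply MvPolynomial.algHom_ext
    rintro ⟨⟨d, hd⟩, j⟩
    have := (hψc d j).trans (hφ d j).symm
    simpa [coeffFun, coeffPoly, hd] using this

/-- Every point of `U_β` gives a unique ideal with quotient based on `β`. -/
theorem existsUnique_ideal (φ : CoordRing k β →ₐ[k] A) :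
    ∃! I : Ideal (MvPolynomial (Fin r) A), IsBasisOfQuotient β I ∧ ∀ d, univPoly φ d ∈ I := by
  classical
  let L : MvPolynomial (Fin r) A →ₗ[A] ({j : Fin r → ℕ // j ∈ β} → A) :=
    (basisMonomials (Fin r) A).constr A fun d j => φ (coeffFun k β (fun i => d i) j)
  have hL : ∀ d, L (mono A d) = fun j => φ (coeffFun k β d j) := by
    intro d
    have := (basisMonomials (Fin r) A).constr_basis A
      (fun d (j : {j : Fin r → ℕ // j ∈ β}) => φ (coeffFun k β (fun i => d i) j))
      (Finsupp.equivFunOnFinite.symm d)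
    simpa [L, mono] using this
  have hLm : ∀ j : {j : Fin r → ℕ // j ∈ β}, L (mono A j.1) = Pi.single j 1 := by
    intro j
    rw [hL]
    ext j'
    rw [coeffFun_mem j.2]
    by_cases h : j = j'
    · subst h; simp
    · rw [if_neg (fun h' => h (Subtype.ext h')), Pi.single_eq_of_ne (Ne.symm h), map_zero]
  let T : Fin r → ({j : Fin r → ℕ // j ∈ β} → A) →ₗ[A] ({j : Fin r → ℕ // j ∈ β} → A) :=
    fun i => Matrix.toLin' (Matrix.of fun j₀ j => φ (coeffFun k β (j.1 + Pi.single i 1) j₀))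
  have hT : ∀ i f, L (X i * f) = T i (L f) := by
    intro i f
    have : L ∘ₗ LinearMap.mulLeft A (X i) = T i ∘ₗ L := by
      apply (basisMonomials (Fin r) A).ext
      intro e
      obtain ⟨d, rfl⟩ := Finsupp.equivFunOnFinite.symm.surjective e
      have h1 : L (X i * mono A d) = T i (L (mono A d)) := by
        rw [← mono_add_single, hL, hL]
        ext j₀
        simp only [T, Matrix.toLin'_apply, Matrix.mulVec, dotProduct, Matrix.of_apply]
        rw [coeffFun_add_single, map_sum]
        refine Finset.sum_congr rfl fun j _ => ?_
        rw [map_mul, mul_comm]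
      simpa [mono] using h1
    exact LinearMap.congr_fun this f
  have hmul : ∀ g f, L f = 0 → L (g * f) = 0 := by
    intro g
    induction g using MvPolynomial.induction_on with
    | C a => intro f hf; rw [C_mul', map_smul, hf, smul_zero]
    | add p q hp hq => intro f hf; rw [add_mul, map_add, hp f hf, hq f hf, add_zero]
    | mul_X p i hp =>
      intro f hf
      rw [mul_assoc]
      exact hp _ (by rw [hT, hf, map_zero])
  let I : Ideal (MvPolynomial (Fin r) A) :=
    { carrier := {f | L f = 0}
      add_mem' := fun {a b} ha hb => by
        simp only [Set.mem_ofPred_eq] at ha hb ⊢; rw [map_add, ha, hb, add_zero]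
      zero_mem' := map_zero L
      smul_mem' := fun c x hx => hmul c x hx }
  have hImem : ∀ f, f ∈ I ↔ L f = 0 := fun f => Iff.rfl
  have hLsum : ∀ v : {j : Fin r → ℕ // j ∈ β} → A, L (∑ j, v j • mono A j.1) = v := by
    intro v
    simp only [map_sum, map_smul, hLm]
    ext j
    simp [Finset.sum_apply, Pi.single_apply]
  -- reduction of an arbitrary polynomial modulo an ideal containing all `F_d`
  have hred : ∀ J : Ideal (MvPolynomial (Fin r) A), (∀ d, univPoly φ d ∈ J) →
      ∀ f, f - ∑ j, L f j • mono A j.1 ∈ J := by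
    intro J hJ f
    induction f using MvPolynomial.induction_on' with
    | monomial e a =>
      obtain ⟨d, rfl⟩ := Finsupp.equivFunOnFinite.symm.surjective e
      have h := J.mul_mem_left (C a) (hJ d)
      have hC : monomial (Finsupp.equivFunOnFinite.symm d) a = a • mono A d := by
        rw [mono, smul_monomial, smul_eq_mul, mul_one]
      rw [hC, map_smul, hL]
      rw [C_mul', univPoly, smul_sub, Finset.smul_sum] at h
      simpa [smul_smul] using h
    | add p q hp hq =>
      have : p + q - ∑ j, L (p + q) j • mono A j.1 =
          (p - ∑ j, L p j • mono A j.1) + (q - ∑ j, L q j • mono A j.1) := by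
        simp only [map_add, Pi.add_apply, add_smul, Finset.sum_add_distrib]
        ring
      rw [this]
      exact J.add_mem hp hq
  have hF : ∀ d, univPoly φ d ∈ I := by
    intro d
    rw [hImem, univPoly, map_sub, hLsum, hL, sub_self]
  refine ⟨I, ⟨⟨?_, ?_⟩, hF⟩, ?_⟩
  · rw [Fintype.linearIndependent_iff]
    intro g hg
    have h : ∑ j, g j • mono A j.1 ∈ I := by
      rw [← Ideal.Quotient.eq_zero_iff_mem]
      change Ideal.Quotient.mkₐ A I (∑ j, g j • mono A j.1) = 0
      simpa only [map_sum, map_smul] using hg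
    rw [hImem, hLsum] at h
    exact fun j => congrFun h j
  · rintro x -
    obtain ⟨f, rfl⟩ := Ideal.Quotient.mkₐ_surjective A I x
    have h : Ideal.Quotient.mkₐ A I (f - ∑ j, L f j • mono A j.1) = 0 :=
      Ideal.Quotient.eq_zero_iff_mem.2 (hred I hF f)
    rw [map_sub, sub_eq_zero, map_sum] at h
    rw [h]
    refine Submodule.sum_mem _ fun j _ => ?_
    rw [map_smul]
    exact Submodule.smul_mem _ _ (Submodule.subset_span ⟨j, rfl⟩)
  · rintro J ⟨hJ, hJF⟩
    ext f
    rw [hImem]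
    constructor
    · intro hf
      have h1 : ∑ j, L f j • mono A j.1 ∈ J := by
        have := J.sub_mem hf (hred J hJF f)
        simpa using this
      have h2 : Ideal.Quotient.mkₐ A J (∑ j, L f j • mono A j.1) = 0 :=
        Ideal.Quotient.eq_zero_iff_mem.2 h1
      rw [map_sum] at h2
      simp only [map_smul] at h2
      funext j
      exact Fintype.linearIndependent_iff.1 hJ.1 _ h2 j
    · intro hf
      have := hred J hJF f
      simpa [hf] using this

/-- The origin of `U_β` corresponds to the monomial ideal `I_β`. -/
theorem ideal_originHom (hβ : IsBasisSet β) (I : Ideal (MvPolynomial (Fin r) k))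
    (hI : IsBasisOfQuotient β I) (hF : ∀ d, univPoly (originHom (k := k) hβ) d ∈ I) :
    I = Ideal.span {m | ∃ d, d ∉ β ∧ m = mono k d} := by
  classical
  have hsub : Ideal.span {m | ∃ d, d ∉ β ∧ m = mono k d} ≤ I := by
    rw [Ideal.span_le]
    rintro _ ⟨d, hd, rfl⟩
    have h := hF d
    have h0 : ∀ j, originHom (k := k) hβ (coeffFun k β d j) = 0 :=
      fun j => aeval_zero_coeffPoly hd j
    simpa [univPoly, h0] using h
  have hred : ∀ f : MvPolynomial (Fin r) k,
      f - ∑ j : {j : Fin r → ℕ // j ∈ β},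
        coeff (Finsupp.equivFunOnFinite.symm j.1) f • mono k j.1 ∈
        Ideal.span {m | ∃ d, d ∉ β ∧ m = mono k d} := by
    intro f
    induction f using MvPolynomial.induction_on' with
    | monomial e a =>
      obtain ⟨d, rfl⟩ := Finsupp.equivFunOnFinite.symm.surjective e
      have hC : monomial (Finsupp.equivFunOnFinite.symm d) a = a • mono k d := by
        rw [mono, smul_monomial, smul_eq_mul, mul_one]
      simp only [coeff_monomial, EmbeddingLike.apply_eq_iff_eq]
      by_cases hd : d ∈ β
      · rw [Finset.sum_eq_single (⟨d, hd⟩ : {j : Fin r → ℕ // j ∈ β})]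
        · simp [hC]
        · intro b _ hb
          rw [if_neg (fun h => hb (Subtype.ext h.symm)), zero_smul]
        · simp
      · rw [Finset.sum_eq_zero, sub_zero, hC, smul_eq_C_mul]
        · exact Ideal.mul_mem_left _ _ (Ideal.subset_span ⟨d, hd, rfl⟩)
        · intro j _
          rw [if_neg (by rintro rfl; exact hd j.2), zero_smul]
    | add p q hp hq =>
      have := Ideal.add_mem _ hp hq
      simp only [coeff_add, add_smul, Finset.sum_add_distrib]
      convert! this using 1
      ring
  refine le_antisymm (fun f hf => ?_) hsub
  have h1 := I.sub_mem hf (hsub (hred f))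
  rw [sub_sub_cancel] at h1
  have h2 := (Ideal.Quotient.eq_zero_iff_mem).2 h1
  change Ideal.Quotient.mkₐ k I _ = 0 at h2
  simp only [map_sum, map_smul] at h2
  have h3 := Fintype.linearIndependent_iff.1 hI.1 _ h2
  have h4 := hred f
  simpa [h3] using h4

end Universal

/-- `β` is a smooth basis set: it is a basis set and `t_β` is a nonsingular point, i.e. the local
ring at `t_β` of `U_β` (equivalently, of the Hilbert scheme) is a regular local ring. -/
def IsSmoothBasisSet (k : Type*) [Field k] {r : ℕ} (β : Finset (Fin r → ℕ)) : Prop :=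
  ∃ hβ : IsBasisSet β,
    haveI : (originIdeal k β).IsPrime := originIdeal_isPrime hβ
    IsRegularLocalRing (Localization.AtPrime (originIdeal k β))

end HilbPoints

/-!
The cotangent space of `t_β` is spanned by the arrows `c^d_j`, and modulo `M ^ 2` the relations say
that an arrow may be translated by any monomial as long as its head stays in `β`, and that it
vanishes once it can be moved so far back that its head would leave the orthant while its tail stays
outside `β`. For a union of two boxes this leaves at most one class for each pair of a variable and
a monomial of `β`, so `dim M / M ^ 2 ≤ r |β|`.

The local dimension at `t_β` is at least `r |β|` for every basis set `β`, so equality holds and the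
point is nonsingular. Ideals of `|β|` distinct points on which the monomials of `β` are independent
give an `r |β|`-dimensional family in `U_β`: the coordinates of the generic such family are
algebraically independent, and they are integral over the coordinate ring of `U_β` because a
coordinate of a point is an eigenvalue of multiplication by a variable. The closure of this family
contains `t_β`: the ideal of the points `(t ^ (s_1 + 1), …, t ^ (s_r + 1))`, `s ∈ β`, is generated
by products of linear forms whose limit at `t = 0` is the monomial ideal `I_β`.

If the last box of a compound box is added in the `x_j`-direction, then its monomials not involving
`x_j` form a box. This fails for the union of two boxes each of which has two sides greater than `1`
in directions where the side of the other is `1`.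
-/

namespace HilbPoints

section Dimension

theorem height_eq_of_isMaximal_mvPolynomial {k : Type*} [Field k] (s : ℕ)
    (P : Ideal (MvPolynomial (Fin s) k)) [hP : P.IsMaximal] : P.height = s := by
  induction s with
  | zero =>
    have hfield : IsField (MvPolynomial (Fin 0) k) :=
      (MvPolynomial.isEmptyRingEquiv k (Fin 0)).toMulEquiv.isField (Field.toIsField k)
    let := hfield.toField
    rw [(Ideal.eq_bot_or_top P).resolve_right hP.ne_top]
    simp
  | succ s ih =>
    let e := (MvPolynomial.finSuccEquiv k s).toRingEquiv
    have hmax : (P.map e).IsMaximal := Ideal.map_isMaximal_of_equiv e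
    have hcomap : ((P.map e).comap Polynomial.C).IsMaximal :=
      Polynomial.isMaximal_comap_C_of_isJacobsonRing _
    have : (P.map e).LiesOver ((P.map e).comap Polynomial.C) := ⟨rfl⟩
    rw [← RingEquiv.height_map e P,
      Polynomial.height_eq_height_add_one ((P.map e).comap Polynomial.C) (P.map e), ih]
    exact (Nat.cast_succ s).symm

theorem card_le_of_isIntegral_mvPolynomial {k L ι : Type*} [Field k] [CommRing L] [IsDomain L]
    [Algebra k L] [Finite ι] {s : ℕ} [Algebra (MvPolynomial (Fin s) k) L]
    [IsScalarTower k (MvPolynomial (Fin s) k) L] [FaithfulSMul (MvPolynomial (Fin s) k) L]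
    {x : ι → L} (hx : AlgebraicIndependent k x)
    (hint : ∀ i, IsIntegral (MvPolynomial (Fin s) k) (x i)) : Nat.card ι ≤ s := by
  let C := integralClosure (MvPolynomial (Fin s) k) L
  let y : ι → C := fun i => ⟨x i, hint i⟩
  have hy : AlgebraicIndependent k y := .of_comp (C.restrictScalars k).val hx
  have htrdeg : Algebra.trdeg k C = s := by
    have h := lift_trdeg_add_eq k (MvPolynomial (Fin s) k) C
    rw [show Algebra.trdeg (MvPolynomial (Fin s) k) C = 0 from trdeg_eq_zero,
      MvPolynomial.trdeg_of_isDomain] at h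
    rw [← Cardinal.lift_inj, ← h]
    simp
  have hcard := hy.lift_cardinalMk_le_trdeg
  have := Fintype.ofFinite ι
  rw [htrdeg] at hcard
  simpa using hcard

theorem card_le_height_of_injective {k R L ι : Type*} [Field k] [CommRing R] [Algebra k R]
    [Algebra.FiniteType k R] [CommRing L] [IsDomain L] [Algebra k L] [Algebra R L]
    [IsScalarTower k R L] [Finite ι] {x : ι → L} (hx : AlgebraicIndependent k x)
    (hint : ∀ i, IsIntegral R (x i)) (hinj : Function.Injective (algebraMap R L))
    (M : Ideal R) [M.IsMaximal] : (Nat.card ι : ℕ∞) ≤ M.height := by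
  have : IsDomain R := hinj.isDomain
  obtain ⟨s, g, hg, hgint⟩ := exists_integral_inj_algHom_of_fg k R
  let : Algebra (MvPolynomial (Fin s) k) R := g.toRingHom.toAlgebra
  let : Algebra (MvPolynomial (Fin s) k) L := ((algebraMap R L).comp g.toRingHom).toAlgebra
  have : IsScalarTower (MvPolynomial (Fin s) k) R L := .of_algebraMap_eq fun _ => rfl
  have : IsScalarTower k (MvPolynomial (Fin s) k) L := .of_algebraMap_eq fun c => by
    rw [IsScalarTower.algebraMap_apply k R L, RingHom.algebraMap_toAlgebra]
    exact congrArg _ (g.commutes c).symm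
  have : FaithfulSMul (MvPolynomial (Fin s) k) R :=
    (faithfulSMul_iff_algebraMap_injective _ _).2 hg
  have : FaithfulSMul (MvPolynomial (Fin s) k) L :=
    (faithfulSMul_iff_algebraMap_injective _ _).2 (hinj.comp hg)
  have : Algebra.IsIntegral (MvPolynomial (Fin s) k) R := ⟨hgint⟩
  have : IsNoetherianRing R := Algebra.FiniteType.isNoetherianRing k R
  have hcard := card_le_of_isIntegral_mvPolynomial (s := s) hx fun i =>
    isIntegral_trans (x i) (hint i)
  have hmax : (M.under (MvPolynomial (Fin s) k)).IsMaximal :=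
    Ideal.isMaximal_comap_of_isIntegral_of_isMaximal M
  rw [Ideal.height_eq_height_add_of_liesOver_of_hasGoingDown
    (M.under (MvPolynomial (Fin s) k)) M, height_eq_of_isMaximal_mvPolynomial]
  exact le_add_right (by exact_mod_cast hcard)

theorem height_le_height_comap_of_surjective {R S : Type*} [CommRing R] [CommRing S]
    {f : R →+* S} (hf : Function.Surjective f) (P : Ideal S) [hP : P.IsPrime] :
    P.height ≤ (P.comap f).height := by
  have h := Order.height_le_height_apply_of_strictMono _
    (RingHom.strictMono_comap_of_surjective hf) ⟨P, hP⟩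
  rwa [← PrimeSpectrum.height_eq_orderHeight, ← PrimeSpectrum.height_eq_orderHeight] at h

theorem card_le_height_of_ker_le {k R L ι : Type*} [Field k] [CommRing R] [Algebra k R]
    [Algebra.FiniteType k R] [CommRing L] [IsDomain L] [Algebra k L] [Finite ι] (φ : R →ₐ[k] L)
    {x : ι → L} (hx : AlgebraicIndependent k x) (hint : ∀ i, φ.toRingHom.IsIntegralElem (x i))
    {M : Ideal R} [M.IsMaximal] (hM : RingHom.ker φ ≤ M) : (Nat.card ι : ℕ∞) ≤ M.height := by
  let π := Ideal.Quotient.mk (RingHom.ker φ)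
  have hπ : Function.Surjective π := Ideal.Quotient.mk_surjective
  let : Algebra (R ⧸ RingHom.ker φ) L := (Ideal.kerLiftAlg φ).toRingHom.toAlgebra
  have : IsScalarTower k (R ⧸ RingHom.ker φ) L :=
    .of_algebraMap_eq fun c => ((Ideal.kerLiftAlg φ).commutes c).symm
  have hmax : (M.map π).IsMaximal :=
    Ideal.IsMaximal.map_of_surjective_of_ker_le hπ (by simpa [π] using hM)
  have hint' (i : ι) : IsIntegral (R ⧸ RingHom.ker φ) (x i) := by
    obtain ⟨p, hp, hp'⟩ := hint i
    exact ⟨p.map π, hp.map _, by rw [Polynomial.eval₂_map]; exact hp'⟩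
  have hcomap : (M.map π).comap π = M := by
    rw [Ideal.comap_map_of_surjective _ hπ, ← RingHom.ker_eq_comap_bot, Ideal.mk_ker,
      sup_eq_left.2 hM]
  calc (Nat.card ι : ℕ∞) ≤ (M.map π).height :=
        card_le_height_of_injective hx hint' (Ideal.kerLiftAlg_injective φ) _
    _ ≤ ((M.map π).comap π).height := height_le_height_comap_of_surjective hπ _
    _ = M.height := by rw [hcomap]

end Dimension

section Regularity

theorem le_span_sup_sq_of_span_toCotangent {R ι : Type*} [CommRing R] {M : Ideal R} {y : ι → M}
    (hy : Submodule.span R (Set.range fun i => M.toCotangent (y i)) = ⊤) :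
    M ≤ Ideal.span (Set.range fun i => (y i : R)) ⊔ M ^ 2 := by
  have hsup : Submodule.span R (Set.range y) ⊔ LinearMap.ker M.toCotangent = ⊤ := by
    rw [← Submodule.comap_map_eq, Submodule.map_span, ← Set.range_comp]
    exact (congrArg _ hy).trans (Submodule.comap_top _)
  have hmap := congrArg (Submodule.map M.subtype) hsup
  rw [Submodule.map_sup, Submodule.map_span, ← Set.range_comp, Ideal.map_toCotangent_ker,
    Submodule.map_subtype_top] at hmap
  exact hmap.ge

theorem spanFinrank_maximalIdeal_le_card {R ι : Type*} [CommRing R] [IsNoetherianRing R]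
    [Fintype ι] {M : Ideal R} [M.IsPrime] {y : ι → M}
    (hy : Submodule.span R (Set.range fun i => M.toCotangent (y i)) = ⊤) :
    (IsLocalRing.maximalIdeal (Localization.AtPrime M)).spanFinrank ≤ Fintype.card ι := by
  let A := Localization.AtPrime M
  let J : Ideal R := Ideal.span (Set.range fun i => (y i : R))
  have hJM : J ≤ M := Ideal.span_le.2 (Set.range_subset_iff.2 fun i => (y i).2)
  have hmap : J.map (algebraMap R A) = IsLocalRing.maximalIdeal A := by
    refine le_antisymm ?_ ?_
    · rw [← Localization.AtPrime.map_eq_maximalIdeal]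
      exact Ideal.map_mono hJM
    · refine Submodule.le_of_le_smul_of_le_jacobson_bot (IsNoetherian.noetherian _)
        (IsLocalRing.maximalIdeal_le_jacobson _) ?_
      have h := Ideal.map_mono (f := algebraMap R A) (le_span_sup_sq_of_span_toCotangent hy)
      rwa [Ideal.map_sup, Ideal.map_pow, Localization.AtPrime.map_eq_maximalIdeal, sq] at h
  rw [← hmap, Ideal.map_span, ← Set.range_comp]
  refine (Submodule.spanFinrank_span_le_ncard_of_finite (Set.finite_range _)).trans ?_
  rw [← Nat.card_coe_set_eq, ← Nat.card_eq_fintype_card]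
  exact Finite.card_range_le _

variable {k R : Type*} [Field k] [CommRing R] [Algebra k R] [IsNoetherianRing R]

theorem spanFinrank_maximalIdeal_le_finrank_cotangent (M : Ideal R) [M.IsPrime]
    [Module.Finite k M.Cotangent] :
    (IsLocalRing.maximalIdeal (Localization.AtPrime M)).spanFinrank ≤
      Module.finrank k M.Cotangent := by
  let b := Module.finBasis k M.Cotangent
  choose y hy using fun i => M.toCotangent_surjective (b i)
  have hspan : Submodule.span R (Set.range fun i => M.toCotangent (y i)) = ⊤ := by
    simp only [hy]
    refine top_le_iff.1 fun x _ => Submodule.span_le_restrictScalars k R _ ?_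
    rw [b.span_eq]
    exact Submodule.mem_top
  simpa using spanFinrank_maximalIdeal_le_card hspan

theorem isRegularLocalRing_and_finrank_cotangent_eq {ι : Type*} [Fintype ι] {M : Ideal R}
    [M.IsPrime] {v : ι → M.Cotangent} (hv : Submodule.span k (Set.range v) = ⊤)
    (hM : (Fintype.card ι : ℕ∞) ≤ M.height) :
    IsRegularLocalRing (Localization.AtPrime M) ∧
      Module.finrank k M.Cotangent = Fintype.card ι := by
  have hfin : Module.Finite k M.Cotangent := .of_surjective _
    (LinearMap.range_eq_top.1 ((Fintype.range_linearCombination k v).trans hv))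
  have hdim := IsLocalization.AtPrime.ringKrullDim_eq_height M (Localization.AtPrime M)
  have hcot := spanFinrank_maximalIdeal_le_finrank_cotangent (k := k) M
  have hcard : Module.finrank k M.Cotangent ≤ Fintype.card ι := finrank_le_of_span_eq_top hv
  have hle : Fintype.card ι ≤
      (IsLocalRing.maximalIdeal (Localization.AtPrime M)).spanFinrank := by
    have h := ringKrullDim_le_spanFinrank_maximalIdeal (Localization.AtPrime M)
    rw [hdim] at h
    exact_mod_cast (WithBot.coe_le_coe.2 hM).trans h
  refine ⟨IsRegularLocalRing.of_spanFinrank_maximalIdeal_le _ ?_,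
    hcard.antisymm (hle.trans hcot)⟩
  rw [hdim]
  exact le_trans (by exact_mod_cast hcot.trans hcard) (WithBot.coe_le_coe.2 hM)

end Regularity

section Points

open MvPolynomial

variable {r : ℕ} {A B : Type*} [CommRing A] [CommRing B]

theorem single_le_iff {i : Fin r} {n : ℕ} {d : Fin r → ℕ} : Pi.single i n ≤ d ↔ n ≤ d i :=
  update_le_iff.trans <| and_iff_left fun _ _ => Nat.zero_le _

theorem induction_add_single {P : (Fin r → ℕ) → Prop} (zero : P 0)
    (add_single : ∀ d i, P d → P (d + Pi.single i 1)) (d : Fin r → ℕ) : P d := by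
  induction d using WellFoundedLT.induction with
  | ind d ih =>
    obtain rfl | ⟨i, hi⟩ := (em (d = 0)).imp_right Function.ne_iff.1
    · exact zero
    · rw [← tsub_add_cancel_of_le (single_le_iff.2 (Nat.one_le_iff_ne_zero.2 hi))]
      refine add_single _ i (ih _ (lt_of_le_of_ne tsub_le_self fun h => ?_))
      have := congrFun h i
      simp at this hi
      omega

theorem mono_zero : mono A (0 : Fin r → ℕ) = 1 := by
  rw [mono, show Finsupp.equivFunOnFinite.symm (0 : Fin r → ℕ) = 0 from Finsupp.ext fun _ => rfl]
  rfl

theorem map_mono (f : A →+* B) (d : Fin r → ℕ) : map f (mono A d) = mono B d := by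
  simp [mono]

theorem span_range_mono : Submodule.span A (Set.range (mono A (r := r))) = ⊤ := by
  rw [← (basisMonomials (Fin r) A).span_eq, coe_basisMonomials,
    ← Finsupp.equivFunOnFinite.symm.surjective.range_comp]
  rfl

theorem map_univPoly {k : Type*} [CommRing k] {β : Finset (Fin r → ℕ)} [Algebra k A] [Algebra k B]
    (g : A →ₐ[k] B) (φ : CoordRing k β →ₐ[k] A) (d : Fin r → ℕ) :
    map (g : A →+* B) (univPoly φ d) = univPoly (g.comp φ) d := by
  simp [univPoly, map_mono, smul_eq_C_mul]

variable {β : Finset (Fin r → ℕ)}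

theorem isBasisOfQuotient_iff {I : Ideal (MvPolynomial (Fin r) A)} :
    IsBasisOfQuotient β I ↔
      (∀ c : {j // j ∈ β} → A, ∑ j, c j • mono A j.1 ∈ I → c = 0) ∧
        ∀ f, ∃ c : {j // j ∈ β} → A, f - ∑ j, c j • mono A j.1 ∈ I := by
  have hsum (c : {j // j ∈ β} → A) : ∑ j, c j • Ideal.Quotient.mk I (mono A j.1) =
      Ideal.Quotient.mk I (∑ j, c j • mono A j.1) := by
    simp only [← Ideal.Quotient.mkₐ_eq_mk A I, map_sum, map_smul]
  refine and_congr ?_ ?_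
  · simp only [Fintype.linearIndependent_iff, Ideal.Quotient.mkₐ_eq_mk, hsum, funext_iff,
      Ideal.Quotient.eq_zero_iff_mem, Pi.zero_apply]
  · rw [top_le_iff, Submodule.eq_top_iff', (Ideal.Quotient.mkₐ_surjective A I).forall]
    refine forall_congr' fun f => ?_
    simp only [Submodule.mem_span_range_iff_exists_fun, Ideal.Quotient.mkₐ_eq_mk, hsum,
      ← Ideal.Quotient.mk_eq_mk_iff_sub_mem, eq_comm]

/-- The ideal of the polynomials that vanish at all the points `p s`. -/
noncomputable def pointsIdeal {ι : Type*} (p : ι → Fin r → A) : Ideal (MvPolynomial (Fin r) A) :=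
  ⨅ s, RingHom.ker (eval (p s))

theorem mem_pointsIdeal {ι : Type*} {p : ι → Fin r → A} {f : MvPolynomial (Fin r) A} :
    f ∈ pointsIdeal p ↔ ∀ s, eval (p s) f = 0 := by
  simp [pointsIdeal]

theorem map_mem_pointsIdeal {ι : Type*} {p : ι → Fin r → A} {f : MvPolynomial (Fin r) A}
    (g : A →+* B) (hf : f ∈ pointsIdeal p) : map g f ∈ pointsIdeal fun s i => g (p s i) :=
  mem_pointsIdeal.2 fun s => by
    have hs := congrArg g (mem_pointsIdeal.1 hf s)
    rwa [eval₂_comp, map_zero, ← eval_map] at hs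

/-- The generalized Vandermonde matrix of the points `p s` and the monomials in `β`. -/
noncomputable def vandermondeMatrix (p : {j // j ∈ β} → Fin r → A) :
    Matrix {j // j ∈ β} {j // j ∈ β} A :=
  .of fun s j => eval (p s) (mono A j.1)

theorem map_vandermondeMatrix (g : A →+* B) (p : {j // j ∈ β} → Fin r → A) :
    g.mapMatrix (vandermondeMatrix p) = vandermondeMatrix fun s i => g (p s i) := by
  ext s j
  simp [vandermondeMatrix, mono, eval_monomial]

theorem eval_sum_smul_mono (p : {j // j ∈ β} → Fin r → A) (c : {j // j ∈ β} → A)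
    (s : {j // j ∈ β}) :
    eval (p s) (∑ j, c j • mono A j.1) = (vandermondeMatrix p).mulVec c s := by
  simp [vandermondeMatrix, Matrix.mulVec, dotProduct, mul_comm]

theorem isBasisOfQuotient_pointsIdeal {p : {j // j ∈ β} → Fin r → A}
    (hp : IsUnit (vandermondeMatrix p).det) : IsBasisOfQuotient β (pointsIdeal p) := by
  classical
  refine isBasisOfQuotient_iff.2 ⟨fun c hc => ?_, fun f => ?_⟩
  · apply Matrix.mulVec_injective_of_isUnit ((Matrix.isUnit_iff_isUnit_det _).2 hp)
    ext s
    rw [← eval_sum_smul_mono, mem_pointsIdeal.1 hc s, Matrix.mulVec_zero, Pi.zero_apply]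
  · refine ⟨(vandermondeMatrix p)⁻¹.mulVec fun s => eval (p s) f, mem_pointsIdeal.2 fun s => ?_⟩
    rw [map_sub, eval_sum_smul_mono, Matrix.mulVec_mulVec, Matrix.mul_nonsing_inv _ hp,
      Matrix.one_mulVec, sub_self]

end Points

section Newton

open MvPolynomial

variable {r : ℕ} {A : Type*} [CommRing A]

/-- The Newton polynomial with nodes `α 0, α 1, …` and leading monomial `x^d`. -/
noncomputable def newton (α : ℕ → A) (d : Fin r → ℕ) : MvPolynomial (Fin r) A :=
  ∏ i, ∏ h ∈ Finset.range (d i), (X i - C (α h))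

theorem newton_add_single (α : ℕ → A) (d : Fin r → ℕ) (i : Fin r) :
    newton α (d + Pi.single i 1) = (X i - C (α (d i))) * newton α d := by
  simp only [newton, ← Finset.mul_prod_erase Finset.univ _ (Finset.mem_univ i), Pi.add_apply,
    Pi.single_eq_same, Finset.prod_range_succ]
  rw [mul_comm _ (X i - _), mul_assoc]
  congr 2
  refine Finset.prod_congr rfl fun t ht => ?_
  rw [Pi.single_eq_of_ne (Finset.ne_of_mem_erase ht), add_zero]

theorem newton_zero_nodes (d : Fin r → ℕ) : newton (0 : ℕ → A) d = mono A d := by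
  induction d using induction_add_single with
  | zero => simp [newton, mono_zero]
  | add_single d i ih => rw [newton_add_single, mono_add_single, ih, Pi.zero_apply, C_0, sub_zero]

theorem map_newton {B : Type*} [CommRing B] (g : A →+* B) (α : ℕ → A) (d : Fin r → ℕ) :
    map g (newton α d) = newton (g ∘ α) d := by
  simp [newton]

theorem eval_newton_eq_zero (α : ℕ → A) {d s : Fin r → ℕ} (h : ¬ d ≤ s) :
    eval (fun i => α (s i)) (newton α d) = 0 := by
  obtain ⟨i, hi⟩ := not_forall.1 h
  rw [newton, map_prod]
  refine Finset.prod_eq_zero (Finset.mem_univ i) ?_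
  rw [map_prod]
  exact Finset.prod_eq_zero (Finset.mem_range.2 (not_le.1 hi)) (by simp)

theorem eval_newton_self_ne_zero [IsDomain A] {α : ℕ → A} (hα : Function.Injective α)
    (d : Fin r → ℕ) : eval (fun i => α (d i)) (newton α d) ≠ 0 := by
  simp only [newton, map_prod, map_sub, eval_X, eval_C, Finset.prod_ne_zero_iff, sub_ne_zero,
    hα.ne_iff]
  exact fun i _ h hh => (Finset.mem_range.1 hh).ne'

theorem mono_sub_newton_mem_span (α : ℕ → A) (d : Fin r → ℕ) :
    mono A d - newton α d ∈ Submodule.span A (mono A '' Set.Iio d) := by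
  induction d using induction_add_single with
  | zero => simp [newton, mono_zero]
  | add_single d i ih =>
    have hlt : d < d + Pi.single i 1 := lt_add_of_pos_right _ (by simp [Pi.single_pos])
    have hmul : X i * (mono A d - newton α d) ∈
        Submodule.span A (mono A '' Set.Iio (d + Pi.single i 1)) := by
      have h := Submodule.apply_mem_span_image_of_mem_span (LinearMap.mulLeft A (X i)) ih
      refine Submodule.span_mono ?_ h
      rintro _ ⟨_, ⟨e, he, rfl⟩, rfl⟩
      exact ⟨_, add_lt_add_left (Set.mem_Iio.1 he) _, mono_add_single e i⟩
    have hnewton : newton α d ∈ Submodule.span A (mono A '' Set.Iio (d + Pi.single i 1)) := by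
      rw [← sub_sub_cancel (mono A d) (newton α d)]
      exact sub_mem (Submodule.subset_span ⟨d, hlt, rfl⟩)
        (Submodule.span_mono (Set.image_mono (Set.Iio_subset_Iio hlt.le)) ih)
    rw [mono_add_single, newton_add_single, sub_mul, C_mul', sub_sub_eq_add_sub, add_sub_right_comm,
      ← mul_sub]
    exact add_mem hmul (Submodule.smul_mem _ _ hnewton)

/-- The distraction of the monomial ideal `I_β`: each generator `x^d` is replaced by a product of
linear forms, the Newton polynomial of `d`. -/
noncomputable def newtonIdeal (α : ℕ → A) (β : Finset (Fin r → ℕ)) :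
    Ideal (MvPolynomial (Fin r) A) :=
  Ideal.span {f | ∃ d, d ∉ β ∧ f = newton α d}

variable {β : Finset (Fin r → ℕ)}

theorem mem_span_mono_sup_newtonIdeal (α : ℕ → A) (f : MvPolynomial (Fin r) A) :
    f ∈ Submodule.span A (Set.range fun j : {j // j ∈ β} => mono A j.1) ⊔
      (newtonIdeal α β).restrictScalars A := by
  set S := Submodule.span A (Set.range fun j : {j // j ∈ β} => mono A j.1) ⊔
    (newtonIdeal α β).restrictScalars A
  have hmono (d : Fin r → ℕ) : mono A d ∈ S := by
    induction d using WellFoundedLT.induction with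
    | ind d ih =>
      by_cases hd : d ∈ β
      · exact Submodule.mem_sup_left (Submodule.subset_span ⟨⟨d, hd⟩, rfl⟩)
      · rw [← sub_add_cancel (mono A d) (newton α d)]
        refine add_mem ?_ (Submodule.mem_sup_right (Ideal.subset_span ⟨d, hd, rfl⟩))
        exact Submodule.span_le.2 (Set.image_subset_iff.2 ih) (mono_sub_newton_mem_span α d)
  have hf : f ∈ Submodule.span A (Set.range (mono A (r := r))) := by
    rw [span_range_mono]
    exact Submodule.mem_top
  exact Submodule.span_le.2 (Set.range_subset_iff.2 hmono) hf

/-- The points with coordinates among the nodes `α 0, α 1, …` and exponents in `β`. -/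
def gridPoint (α : ℕ → A) (s : {j // j ∈ β}) (i : Fin r) : A :=
  α (s.1 i)

theorem newtonIdeal_le_pointsIdeal (hβ : IsBasisSet β) (α : ℕ → A) :
    newtonIdeal α β ≤ pointsIdeal (gridPoint (β := β) α) := by
  refine Ideal.span_le.2 ?_
  rintro _ ⟨d, hd, rfl⟩
  exact mem_pointsIdeal.2 fun s => eval_newton_eq_zero α fun h => hd (hβ.2 _ s.2 _ h)

variable [IsDomain A] {α : ℕ → A}

theorem det_vandermondeMatrix_gridPoint_ne_zero (hβ : IsBasisSet β) (hα : Function.Injective α) :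
    (vandermondeMatrix (gridPoint (β := β) α)).det ≠ 0 := by
  classical
  intro hdet
  obtain ⟨w, hw, hw0⟩ := Matrix.exists_vecMul_eq_zero_iff.2 hdet
  let ℓ : MvPolynomial (Fin r) A →ₗ[A] A :=
    ∑ s, w s • (aeval (gridPoint (β := β) α s)).toLinearMap
  have hℓ (f : MvPolynomial (Fin r) A) : ℓ f = ∑ s, w s * eval (gridPoint α s) f := by
    simp [ℓ, aeval_eq_eval]
  have hker (f : MvPolynomial (Fin r) A) : ℓ f = 0 := by
    refine (sup_le (Submodule.span_le.2 ?_) fun g hg => ?_ :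
      _ ≤ LinearMap.ker ℓ) (mem_span_mono_sup_newtonIdeal (β := β) α f)
    · rintro _ ⟨j, rfl⟩
      exact (hℓ _).trans (congrFun hw0 j)
    · have hg := mem_pointsIdeal.1 (newtonIdeal_le_pointsIdeal hβ α hg)
      simp [hℓ, hg]
  obtain ⟨m, hm⟩ := Finset.exists_maximal (s := Finset.univ.filter fun s => w s ≠ 0) <| by
    obtain ⟨s, hs⟩ := Function.ne_iff.1 hw
    exact ⟨s, by simpa using hs⟩
  have hwm : w m ≠ 0 := (Finset.mem_filter.1 hm.1).2
  have hsum := hker (newton α m.1)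
  rw [hℓ, Finset.sum_eq_single m (fun s _ hs => ?_) (by simp)] at hsum
  · exact mul_ne_zero hwm (eval_newton_self_ne_zero hα m.1) hsum
  · by_cases hws : w s = 0
    · rw [hws, zero_mul]
    · refine mul_eq_zero_of_right _ (eval_newton_eq_zero α fun hle => hs ?_)
      exact le_antisymm (hm.2 (by simpa using hws) hle) hle

theorem isBasisOfQuotient_newtonIdeal (hβ : IsBasisSet β) (hα : Function.Injective α) :
    IsBasisOfQuotient β (newtonIdeal α β) := by
  refine isBasisOfQuotient_iff.2 ⟨fun c hc => ?_, fun f => ?_⟩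
  · refine Matrix.eq_zero_of_mulVec_eq_zero (det_vandermondeMatrix_gridPoint_ne_zero hβ hα) ?_
    ext s
    rw [← eval_sum_smul_mono]
    exact mem_pointsIdeal.1 (newtonIdeal_le_pointsIdeal hβ α hc) s
  · obtain ⟨g, hg, h, hh, rfl⟩ := Submodule.mem_sup.1 (mem_span_mono_sup_newtonIdeal (β := β) α f)
    obtain ⟨c, rfl⟩ := (Submodule.mem_span_range_iff_exists_fun A).1 hg
    exact ⟨c, by simpa using hh⟩

end Newton

section Origin

open MvPolynomial

variable {k : Type*} [CommRing k] {r : ℕ} {β : Finset (Fin r → ℕ)}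

theorem isBasisOfQuotient_span_mono (hβ : IsBasisSet β) :
    IsBasisOfQuotient β (Ideal.span {m | ∃ d, d ∉ β ∧ m = mono k d}) := by
  obtain ⟨I, ⟨hI, hF⟩, -⟩ := existsUnique_ideal (originHom (k := k) hβ)
  rwa [← ideal_originHom hβ I hI hF]

theorem univPoly_originHom_mem_span_mono (hβ : IsBasisSet β) (d : Fin r → ℕ) :
    univPoly (originHom (k := k) hβ) d ∈ Ideal.span {m | ∃ d, d ∉ β ∧ m = mono k d} := by
  obtain ⟨I, ⟨hI, hF⟩, -⟩ := existsUnique_ideal (originHom (k := k) hβ)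
  rw [← ideal_originHom hβ I hI hF]
  exact hF d

/-- The distraction specializes to `I_β` when all nodes become zero. -/
theorem comp_eq_originHom_of_univPoly_mem_newtonIdeal {A : Type*} [CommRing A] [Algebra k A]
    (hβ : IsBasisSet β) {α : ℕ → A} {φ : CoordRing k β →ₐ[k] A}
    (hφ : ∀ d, univPoly φ d ∈ newtonIdeal α β) {ε : A →ₐ[k] k}
    (hε : ∀ n, ε (α n) = 0) : ε.comp φ = originHom hβ := by
  have hle : (newtonIdeal α β).map (map (ε : A →+* k)) ≤
      Ideal.span {m | ∃ d, d ∉ β ∧ m = mono k d} := by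
    rw [newtonIdeal, Ideal.map_span, Ideal.span_le]
    rintro _ ⟨_, ⟨d, hd, rfl⟩, rfl⟩
    refine Ideal.subset_span ⟨d, hd, ?_⟩
    rw [map_newton, ← newton_zero_nodes, show (ε : A →+* k) ∘ α = 0 from funext hε]
  refine (existsUnique_point _ (isBasisOfQuotient_span_mono hβ)).unique (fun d => ?_)
    (univPoly_originHom_mem_span_mono hβ)
  rw [← map_univPoly]
  exact hle (Ideal.mem_map_of_mem _ (hφ d))

theorem originIdeal_isMaximal {k : Type*} [Field k] (hβ : IsBasisSet β) :
    (originIdeal k β).IsMaximal := by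
  rw [← ker_originHom hβ]
  exact RingHom.ker_isMaximal_of_surjective _
    fun c => ⟨algebraMap k _ c, (originHom (k := k) hβ).commutes c⟩

theorem IsBasisSet.zero_mem (hβ : IsBasisSet β) : (0 : Fin r → ℕ) ∈ β := by
  obtain ⟨d, hd⟩ := hβ.1
  exact hβ.2 d hd 0 fun _ => Nat.zero_le _

theorem coeffFun_mem_adjoin (hβ : IsBasisSet β) (d : Fin r → ℕ) (j : {j // j ∈ β}) :
    coeffFun k β d j ∈ Algebra.adjoin k (Set.range
      fun x : ({j // j ∈ β} × Fin r) × {j // j ∈ β} =>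
        coeffFun k β (x.1.1.1 + Pi.single x.1.2 1) x.2) := by
  induction d using induction_add_single generalizing j with
  | zero =>
    rw [coeffFun_mem hβ.zero_mem]
    split_ifs
    exacts [one_mem _, zero_mem _]
  | add_single d i ih =>
    rw [coeffFun_add_single]
    exact sum_mem fun t _ => mul_mem (ih t) (Algebra.subset_adjoin ⟨((t, i), j), rfl⟩)

theorem finiteType_coordRing (hβ : IsBasisSet β) : Algebra.FiniteType k (CoordRing k β) := by
  refine ⟨Subalgebra.fg_def.2 ⟨Set.range fun x : ({j // j ∈ β} × Fin r) × {j // j ∈ β} =>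
    coeffFun k β (x.1.1.1 + Pi.single x.1.2 1) x.2, Set.finite_range _,
    Algebra.eq_top_iff.2 fun x => ?_⟩⟩
  obtain ⟨F, rfl⟩ := Ideal.Quotient.mk_surjective x
  induction F using MvPolynomial.induction_on with
  | C c => exact Subalgebra.algebraMap_mem _ c
  | add p q hp hq => exact add_mem hp hq
  | mul_X p a hp =>
    have h := coeffFun_mem_adjoin (k := k) hβ a.1.1 a.2
    rw [coeffFun, coeffPoly, dif_neg a.1.2] at h
    exact mul_mem hp h

end Origin

section PrincipalComponent

open MvPolynomial

variable {r : ℕ} {β : Finset (Fin r → ℕ)}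

theorem isIntegralElem_of_univPoly_mem_pointsIdeal {k A ι : Type*} [CommRing k] [CommRing A]
    [IsDomain A] [Algebra k A] {φ : CoordRing k β →ₐ[k] A} {p : ι → Fin r → A}
    (hφ : ∀ d, univPoly φ d ∈ pointsIdeal p) (s : ι) (i : Fin r) :
    φ.toRingHom.IsIntegralElem (p s i) := by
  let : Algebra (CoordRing k β) A := φ.toRingHom.toAlgebra
  let N : Submodule (CoordRing k β) A :=
    Submodule.span _ (Set.range fun j : {j // j ∈ β} => eval (p s) (mono A j.1))
  have hN (d : Fin r → ℕ) : eval (p s) (mono A d) ∈ N := by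
    have h := mem_pointsIdeal.1 (hφ d) s
    rw [univPoly, map_sub, sub_eq_zero, map_sum] at h
    rw [h]
    refine sum_mem fun j _ => ?_
    rw [smul_eval]
    exact N.smul_mem (coeffFun k β d j) (Submodule.subset_span ⟨j, rfl⟩)
  have hmul : ∀ n ∈ N, p s i • n ∈ N := fun n hn => by
    suffices N ≤ N.comap (LinearMap.mulLeft (CoordRing k β) (p s i)) from this hn
    refine Submodule.span_le.2 ?_
    rintro _ ⟨j, rfl⟩
    have h := hN (j.1 + Pi.single i 1)
    rwa [mono_add_single, map_mul, eval_X] at h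
  have hone : (1 : A) ∈ N := by simpa [mono_zero] using hN 0
  exact isIntegral_of_smul_mem_submodule N ((Submodule.ne_bot_iff N).2 ⟨1, hone, one_ne_zero⟩)
    (Submodule.fg_span (Set.finite_range _)) _ hmul

section Generic

variable (k : Type*) [CommRing k] (β)

/-- The Vandermonde determinant of the family of points, indexed by `β`, whose coordinates are
independent variables. -/
noncomputable def genericDet : MvPolynomial ({j // j ∈ β} × Fin r) k :=
  (vandermondeMatrix fun (s : {j // j ∈ β}) i => X (s, i)).det

/-- The coordinate ring of the families of points indexed by `β` on which the monomials in `β` are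
independent. -/
abbrev GenericRing : Type _ :=
  Localization.Away (genericDet β k)

/-- The universal family of points indexed by `β` on which the monomials in `β` are independent. -/
noncomputable def genericPoint (s : {j // j ∈ β}) (i : Fin r) : GenericRing β k :=
  algebraMap (MvPolynomial ({j // j ∈ β} × Fin r) k) _ (X (s, i))

theorem isUnit_det_vandermondeMatrix_genericPoint :
    IsUnit (vandermondeMatrix (genericPoint β k)).det := by
  have hdet : algebraMap _ (GenericRing β k) (genericDet β k) =
      (vandermondeMatrix (genericPoint β k)).det :=
    (RingHom.map_det _ _).trans (congrArg Matrix.det (map_vandermondeMatrix _ _))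
  rw [← hdet]
  exact IsLocalization.Away.algebraMap_isUnit _

variable {k β} {A : Type*} [CommRing A] [Algebra k A]

theorem aeval_genericDet (p : {j // j ∈ β} → Fin r → A) :
    aeval (fun x : {j // j ∈ β} × Fin r => p x.1 x.2) (genericDet β k) =
      (vandermondeMatrix p).det := by
  have h := RingHom.map_det (aeval (R := k) fun x : {j // j ∈ β} × Fin r => p x.1 x.2).toRingHom
    (vandermondeMatrix fun s i => X (s, i))
  rw [map_vandermondeMatrix] at h
  simpa [genericDet] using h

theorem exists_map_genericPoint_eq {p : {j // j ∈ β} → Fin r → A}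
    (hp : IsUnit (vandermondeMatrix p).det) :
    ∃ g : GenericRing β k →ₐ[k] A, ∀ s i, g (genericPoint β k s i) = p s i := by
  let f : MvPolynomial ({j // j ∈ β} × Fin r) k →ₐ[k] A := aeval fun x => p x.1 x.2
  have hf (y : Submonoid.powers (genericDet β k)) : IsUnit (f y) := by
    obtain ⟨_, n, rfl⟩ := y
    rw [map_pow, aeval_genericDet]
    exact hp.pow n
  exact ⟨IsLocalization.liftAlgHom hf, fun s i =>
    (IsLocalization.lift_eq _ _).trans (aeval_X _ _)⟩

end Generic

theorem injective_X_pow_succ {R : Type*} [Semiring R] [Nontrivial R] :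
    Function.Injective fun n : ℕ => (Polynomial.X : Polynomial R) ^ (n + 1) := fun m n h => by
  simpa using congrArg Polynomial.natDegree h

theorem genericDet_ne_zero {k : Type*} [CommRing k] [IsDomain k] (hβ : IsBasisSet β) :
    genericDet β k ≠ 0 := fun h =>
  det_vandermondeMatrix_gridPoint_ne_zero hβ (injective_X_pow_succ (R := k)) <| by
    rw [← aeval_genericDet (k := k), h, map_zero]

theorem ker_le_originIdeal {k : Type*} [CommRing k] [IsDomain k] (hβ : IsBasisSet β)
    {φ : CoordRing k β →ₐ[k] GenericRing β k}
    (hφ : ∀ d, univPoly φ d ∈ pointsIdeal (genericPoint β k)) :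
    RingHom.ker φ ≤ originIdeal k β := by
  let α : ℕ → Polynomial k := fun n => Polynomial.X ^ (n + 1)
  have hα : Function.Injective α := injective_X_pow_succ
  let K := FractionRing (Polynomial k)
  let ι : Polynomial k →ₐ[k] K := IsScalarTower.toAlgHom k _ _
  have hι : Function.Injective ι := IsFractionRing.injective _ _
  obtain ⟨χ, hχ, -⟩ := existsUnique_point (k := k) _ (isBasisOfQuotient_newtonIdeal hβ hα)
  have hdet : IsUnit (vandermondeMatrix (gridPoint (β := β) (ι ∘ α))).det :=
    (det_vandermondeMatrix_gridPoint_ne_zero hβ (hι.comp hα)).isUnit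
  obtain ⟨g, hg⟩ := exists_map_genericPoint_eq (k := k) hdet
  have hcomp : g.comp φ = ι.comp χ := by
    refine (existsUnique_point _ (isBasisOfQuotient_pointsIdeal hdet)).unique
      (fun d => ?_) (fun d => ?_)
    · have h := map_mem_pointsIdeal (g : GenericRing β k →+* K) (hφ d)
      simpa only [map_univPoly, RingHom.coe_coe, hg] using h
    · have h := map_mem_pointsIdeal (ι : Polynomial k →+* K)
        (newtonIdeal_le_pointsIdeal hβ α (hχ d))
      rwa [map_univPoly] at h
  intro F hF
  have hχF : χ F = 0 := hι <| by
    rw [map_zero, ← AlgHom.comp_apply, ← hcomp, AlgHom.comp_apply, RingHom.mem_ker.1 hF, map_zero]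
  rw [← ker_originHom hβ, RingHom.mem_ker,
    ← comp_eq_originHom_of_univPoly_mem_newtonIdeal hβ hχ (ε := Polynomial.aeval 0)
      (by simp [α]), AlgHom.comp_apply, hχF, map_zero]

theorem card_mul_le_height_originIdeal {k : Type*} [Field k] (hβ : IsBasisSet β) :
    ((β.card * r : ℕ) : ℕ∞) ≤ (originIdeal k β).height := by
  have := finiteType_coordRing (k := k) hβ
  have := originIdeal_isMaximal (k := k) hβ
  have hpow := powers_le_nonZeroDivisors_of_noZeroDivisors (genericDet_ne_zero (k := k) hβ)
  have : IsDomain (GenericRing β k) := IsLocalization.isDomain_localization hpow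
  obtain ⟨φ, hφ, -⟩ := existsUnique_point (k := k) _
    (isBasisOfQuotient_pointsIdeal (isUnit_det_vandermondeMatrix_genericPoint β k))
  have hind : AlgebraicIndependent k
      fun x : {j // j ∈ β} × Fin r => genericPoint β k x.1 x.2 :=
    (MvPolynomial.algebraicIndependent_X _ k).map'
      (f := IsScalarTower.toAlgHom k _ (GenericRing β k)) (IsLocalization.injective _ hpow)
  simpa using card_le_height_of_ker_le φ hind
    (fun x => isIntegralElem_of_univPoly_mem_pointsIdeal hφ x.1 x.2)
    (ker_le_originIdeal hβ hφ)

end PrincipalComponent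

section CotangentSpace

variable {k : Type*} [CommRing k] {r : ℕ} {β : Finset (Fin r → ℕ)}

theorem coeffFun_mem_originIdeal {d : Fin r → ℕ} (hd : d ∉ β) (j : {j : Fin r → ℕ // j ∈ β}) :
    coeffFun k β d j ∈ originIdeal k β :=
  Ideal.subset_span ⟨d, j, hd, rfl⟩

variable (k β) in
open Classical in
/-- The class modulo `M ^ 2` of the coefficient function of the arrow from `d` to `j`. It is set to
zero for pairs that are not arrows of `β`. -/
noncomputable def arrowClass (d j : Fin r → ℕ) : (originIdeal k β).Cotangent :=
  if h : d ∉ β ∧ j ∈ β then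
    (originIdeal k β).toCotangent ⟨coeffFun k β d ⟨j, h.2⟩, coeffFun_mem_originIdeal h.1 _⟩
  else 0

theorem arrowClass_of_notMem_of_mem {d j : Fin r → ℕ} (hd : d ∉ β) (hj : j ∈ β) :
    arrowClass k β d j =
      (originIdeal k β).toCotangent ⟨coeffFun k β d ⟨j, hj⟩, coeffFun_mem_originIdeal hd _⟩ :=
  dif_pos ⟨hd, hj⟩

theorem coeffFun_mul_coeffFun_mem_sq {d : Fin r → ℕ} (hd : d ∉ β) (i : Fin r)
    (j j₀ : {j : Fin r → ℕ // j ∈ β}) (hj : j.1 + Pi.single i 1 ≠ j₀.1) :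
    coeffFun k β d j * coeffFun k β (j.1 + Pi.single i 1) j₀ ∈ originIdeal k β ^ 2 := by
  by_cases h : j.1 + Pi.single i 1 ∈ β
  · simp [coeffFun_mem h, hj]
  · rw [pow_two]
    exact Ideal.mul_mem_mul (coeffFun_mem_originIdeal hd j) (coeffFun_mem_originIdeal h j₀)

theorem arrowClass_add_single_add_single (hβ : IsBasisSet β) {d j : Fin r → ℕ} (hd : d ∉ β)
    (i : Fin r) (hj : j + Pi.single i 1 ∈ β) :
    arrowClass k β (d + Pi.single i 1) (j + Pi.single i 1) = arrowClass k β d j := by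
  classical
  have hj₀ : j ∈ β := hβ.2 _ hj _ le_self_add
  rw [arrowClass_of_notMem_of_mem (add_single_notMem hβ hd _) hj,
    arrowClass_of_notMem_of_mem hd hj₀, Ideal.toCotangent_eq]
  simp only
  rw [coeffFun_add_single, ← Finset.add_sum_erase _ _ (Finset.mem_univ ⟨j, hj₀⟩),
    coeffFun_mem hj, if_pos rfl, mul_one, add_sub_cancel_left]
  refine Ideal.sum_mem _ fun t ht => coeffFun_mul_coeffFun_mem_sq hd i t _ fun h => ?_
  exact (Finset.mem_erase.1 ht).1 (Subtype.ext (add_right_cancel h))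

theorem arrowClass_add_single_eq_zero (hβ : IsBasisSet β) {d j : Fin r → ℕ} (hd : d ∉ β)
    {i : Fin r} (hj : j i = 0) : arrowClass k β (d + Pi.single i 1) j = 0 := by
  by_cases hjβ : j ∈ β
  · rw [arrowClass_of_notMem_of_mem (add_single_notMem hβ hd _) hjβ, Ideal.toCotangent_eq_zero]
    simp only
    rw [coeffFun_add_single]
    refine Ideal.sum_mem _ fun t _ => coeffFun_mul_coeffFun_mem_sq hd i t _ fun h => ?_
    simpa [hj] using congrFun h i
  · exact dif_neg fun h => hjβ h.2

open Classical in
theorem arrowClass_add (hβ : IsBasisSet β) {d : Fin r → ℕ} (hd : d ∉ β) (e : Fin r → ℕ)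
    {j : Fin r → ℕ} (hj : j ∈ β) :
    arrowClass k β (d + e) j = if e ≤ j then arrowClass k β d (j - e) else 0 := by
  induction e using induction_add_single generalizing j with
  | zero => simp
  | add_single e i ih =>
    rw [← add_assoc]
    by_cases hi : j i = 0
    · rw [arrowClass_add_single_eq_zero hβ (add_single_notMem hβ hd e) hi, if_neg]
      intro h
      simpa [hi] using h i
    · obtain ⟨j, rfl⟩ := le_iff_exists_add'.1 (single_le_iff.2 (Nat.one_le_iff_ne_zero.2 hi))
      rw [arrowClass_add_single_add_single hβ (add_single_notMem hβ hd e) i hj,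
        ih (hβ.2 _ hj _ le_self_add), add_tsub_add_eq_tsub_right]
      simp only [add_le_add_iff_right]

theorem arrowClass_add_add (hβ : IsBasisSet β) {d e j : Fin r → ℕ} (hd : d ∉ β)
    (hj : j + e ∈ β) : arrowClass k β (d + e) (j + e) = arrowClass k β d j := by
  rw [arrowClass_add hβ hd e hj, if_pos le_add_self, add_tsub_cancel_right]

theorem arrowClass_add_eq_zero (hβ : IsBasisSet β) {d e j : Fin r → ℕ} (hd : d ∉ β)
    (hj : j ∈ β) (he : ¬ e ≤ j) : arrowClass k β (d + e) j = 0 := by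
  rw [arrowClass_add hβ hd e hj, if_neg he]

theorem arrowClass_mem_of_le (hβ : IsBasisSet β) {W : Submodule k (originIdeal k β).Cotangent}
    {d d' j : Fin r → ℕ} (hd : d ∉ β) (hW : ∀ j ∈ β, arrowClass k β d j ∈ W) (hle : d ≤ d')
    (hj : j ∈ β) : arrowClass k β d' j ∈ W := by
  classical
  rw [← add_tsub_cancel_of_le hle, arrowClass_add hβ hd _ hj]
  split_ifs
  · exact hW _ (hβ.2 _ hj _ tsub_le_self)
  · exact W.zero_mem

theorem smul_cotangent_eq (hβ : IsBasisSet β) (x : CoordRing k β)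
    (v : (originIdeal k β).Cotangent) : x • v = originHom (k := k) hβ x • v := by
  have hx : x - algebraMap k _ (originHom (k := k) hβ x) ∈ originIdeal k β := by
    rw [← ker_originHom hβ, RingHom.mem_ker]
    simp
  rw [← algebraMap_smul (CoordRing k β) (originHom hβ x) v, ← sub_eq_zero]
  exact (sub_smul x _ v).symm.trans (Ideal.Cotangent.smul_eq_zero_of_mem hx v)

theorem eq_top_of_arrowClass_mem (hβ : IsBasisSet β)
    {W : Submodule k (originIdeal k β).Cotangent}
    (hW : ∀ d ∉ β, ∀ j ∈ β, arrowClass k β d j ∈ W) : W = ⊤ := by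
  refine Submodule.eq_top_iff'.2 fun v => ?_
  obtain ⟨⟨x, hx⟩, rfl⟩ := (originIdeal k β).toCotangent_surjective v
  induction hx using Submodule.span_induction with
  | mem c hc =>
    obtain ⟨d, j, hd, rfl⟩ := hc
    simpa only [arrowClass_of_notMem_of_mem hd j.2] using hW d hd j.1 j.2
  | zero => exact (map_zero (originIdeal k β).toCotangent).symm ▸ W.zero_mem
  | add x y hx hy hxW hyW =>
    simpa only [← map_add] using! W.add_mem hxW hyW
  | smul c x hx hxW =>
    have h := W.smul_mem (originHom (k := k) hβ c) hxW
    rw [← smul_cotangent_eq hβ, ← map_smul] at h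
    exact h

end CotangentSpace

section TwoBoxes

theorem mem_box {r : ℕ} {w d : Fin r → ℕ} : d ∈ box w ↔ ∀ i, d i < w i := by
  simp [box]

theorem isBasisSet_box_union {r : ℕ} {a : Fin r → ℕ} (b : Fin r → ℕ) (ha : ∀ i, 0 < a i) :
    IsBasisSet (box a ∪ box b) := by
  refine ⟨⟨0, Finset.mem_union_left _ (mem_box.2 ha)⟩, fun d hd e he => ?_⟩
  simp only [Finset.mem_union, mem_box] at hd ⊢
  exact hd.imp (fun h t => (he t).trans_lt (h t)) fun h t => (he t).trans_lt (h t)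

theorem add_single_mem_box {r : ℕ} {w d : Fin r → ℕ} (hd : d ∈ box w) {i : Fin r} {n : ℕ}
    (hi : d i + n < w i) : d + Pi.single i n ∈ box w := by
  rw [mem_box] at hd ⊢
  intro t
  obtain rfl | ht := eq_or_ne t i
  · simpa using hi
  · simpa [ht] using hd t

variable {k : Type*} [CommRing k] {r : ℕ} {β : Finset (Fin r → ℕ)} {a b : Fin r → ℕ}

theorem single_notMem_box_union (hab : β = box a ∪ box b) {i : Fin r} (hi : b i ≤ a i) :
    Pi.single i (a i) ∉ β := by
  simp only [hab, Finset.mem_union, mem_box, not_or, not_forall, not_lt]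
  exact ⟨⟨i, by simp⟩, i, by simpa using hi⟩

theorem single_add_single_notMem_box_union (hab : β = box a ∪ box b) (i p : Fin r) :
    Pi.single i (b i) + Pi.single p (a p) ∉ β := by
  simp only [hab, Finset.mem_union, mem_box, not_or, not_forall, not_lt]
  exact ⟨⟨p, by simp⟩, i, by simp⟩

/-- The product of the powers `x_p ^ a_p` over the directions `p` in which `j` can be moved by `a_p`
without leaving `box b`. -/
def shift (a b j : Fin r → ℕ) : Fin r → ℕ :=
  fun p => if j p + a p < b p then a p else 0

theorem add_shift_mem_box {j : Fin r → ℕ} (hj : j ∈ box b) : j + shift a b j ∈ box b := by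
  rw [mem_box] at hj ⊢
  intro p
  have := hj p
  simp only [Pi.add_apply, shift]
  split_ifs <;> omega

theorem single_le_shift {j : Fin r → ℕ} {p : Fin r} (hp : j p + a p < b p) :
    Pi.single p (a p) ≤ shift a b j :=
  single_le_iff.2 (if_pos hp).ge

variable (k β a b) in
open Classical in
/-- The class indexed by a direction `i` with `b i ≤ a i` and a head `j`, in the spanning family of
the cotangent space at `box a ∪ box b`. The arrow from `x_i ^ a_i` to `j` is the obvious choice, but
when it has translates inside `box b` they come from an arrow with tail `x_i ^ b_i · x_p ^ a_p`,
which is then the one to take. Translating by the whole `shift a b j` avoids choosing `p`. -/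
noncomputable def sideClass (i : Fin r) (j : Fin r → ℕ) : (originIdeal k β).Cotangent :=
  if j ∈ box b ∧ ∃ p, j p + a p < b p then
    arrowClass k β (Pi.single i (b i) + shift a b j) (j + shift a b j)
  else arrowClass k β (Pi.single i (a i)) j

theorem arrowClass_mixed_eq_sideClass (hβ : IsBasisSet β) (hab : β = box a ∪ box b)
    {i p : Fin r} {j : Fin r → ℕ} (hj : j ∈ box b) (hp : j p + a p < b p) :
    arrowClass k β (Pi.single i (b i) + Pi.single p (a p)) (j + Pi.single p (a p)) =
      sideClass k β a b i j := by
  have hle := add_tsub_cancel_of_le (single_le_shift hp)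
  rw [sideClass, if_pos ⟨hj, p, hp⟩, ← hle, ← add_assoc, ← add_assoc, arrowClass_add_add hβ
    (single_add_single_notMem_box_union hab i p)]
  rw [add_assoc, hle, hab]
  exact Finset.mem_union_right _ (add_shift_mem_box hj)

theorem arrowClass_pure_mem (hβ : IsBasisSet β) (hab : β = box a ∪ box b)
    {W : Submodule k (originIdeal k β).Cotangent} {i : Fin r} (hi : b i ≤ a i)
    (hW : ∀ j ∈ β, sideClass k β a b i j ∈ W) {j : Fin r → ℕ} (hj : j ∈ β) :
    arrowClass k β (Pi.single i (a i)) j ∈ W := by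
  by_cases hmove : j ∈ box b ∧ ∃ p, j p + a p < b p
  · obtain ⟨hjb, p, hp⟩ := hmove
    have hpi : p ≠ i := by rintro rfl; omega
    have hmixed := single_add_single_notMem_box_union hab i p
    have hmem : j + Pi.single p (a p) ∈ β :=
      hab ▸ Finset.mem_union_right _ (add_single_mem_box hjb hp)
    rw [← arrowClass_add_add hβ (single_notMem_box_union hab hi) hmem,
      ← add_tsub_cancel_of_le hi, Pi.single_add, add_right_comm]
    by_cases hji : a i - b i ≤ j i
    · obtain ⟨u, rfl⟩ := le_iff_exists_add'.1 (single_le_iff.2 hji)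
      rw [add_right_comm u] at hmem ⊢
      rw [arrowClass_add_add hβ hmixed hmem, arrowClass_mixed_eq_sideClass hβ hab]
      · exact hW u (hβ.2 _ hj _ le_self_add)
      · exact mem_box.2 fun t => (mem_box.1 hjb t).trans_le' le_self_add
      · simpa [hpi] using hp
    · rw [arrowClass_add_eq_zero hβ hmixed hmem]
      · exact W.zero_mem
      · simpa [single_le_iff, hpi.symm] using hji
  · simpa only [sideClass, if_neg hmove] using hW j hj

theorem arrowClass_mixed_mem (hβ : IsBasisSet β) (hab : β = box a ∪ box b)
    {W : Submodule k (originIdeal k β).Cotangent} {i p : Fin r} (hip : i ≠ p) (hp : a p ≤ b p)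
    (hW : ∀ j ∈ β, sideClass k β a b i j ∈ W) {j : Fin r → ℕ} (hj : j ∈ box b) :
    arrowClass k β (Pi.single i (b i) + Pi.single p (a p)) j ∈ W := by
  by_cases hjp : a p ≤ j p
  · obtain ⟨u, rfl⟩ := le_iff_exists_add'.1 (single_le_iff.2 hjp)
    have hu : u ∈ box b := mem_box.2 fun t => (mem_box.1 hj t).trans_le' le_self_add
    rw [arrowClass_mixed_eq_sideClass hβ hab hu (by simpa using mem_box.1 hj p)]
    exact hW u (hab ▸ Finset.mem_union_right _ hu)
  · have hmem : j + Pi.single p (b p - a p) ∈ β :=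
      hab ▸ Finset.mem_union_right _ (add_single_mem_box hj (by omega))
    rw [← arrowClass_add_add hβ (single_add_single_notMem_box_union hab i p) hmem, add_assoc,
      ← Pi.single_add, add_tsub_cancel_of_le hp, add_comm,
      arrowClass_add_eq_zero hβ
        (single_notMem_box_union (hab.trans (Finset.union_comm _ _)) hp) hmem]
    · exact W.zero_mem
    · simpa [single_le_iff, hip] using mem_box.1 hj i

theorem arrowClass_mem_of_sideClass_mem (hβ : IsBasisSet β) (hab : β = box a ∪ box b)
    {W : Submodule k (originIdeal k β).Cotangent}
    (hWa : ∀ i, b i < a i → ∀ j ∈ β, sideClass k β a b i j ∈ W)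
    (hWb : ∀ i, a i ≤ b i → ∀ j ∈ β, sideClass k β b a i j ∈ W) {d j : Fin r → ℕ}
    (hd : d ∉ β) (hj : j ∈ β) : arrowClass k β d j ∈ W := by
  have hba : β = box b ∪ box a := hab.trans (Finset.union_comm _ _)
  obtain ⟨⟨p, hp⟩, i, hi⟩ : (∃ p, a p ≤ d p) ∧ ∃ i, b i ≤ d i := by
    simpa only [hab, Finset.mem_union, mem_box, not_or, not_forall, not_lt] using hd
  obtain hpa | hpa := lt_or_ge (b p) (a p)
  · exact arrowClass_mem_of_le hβ (single_notMem_box_union hab hpa.le)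
      (fun _ => arrowClass_pure_mem hβ hab hpa.le (hWa p hpa)) (single_le_iff.2 hp) hj
  obtain hib | hib := le_or_gt (a i) (b i)
  · exact arrowClass_mem_of_le hβ (single_notMem_box_union hba hib)
      (fun _ => arrowClass_pure_mem hβ hba hib (hWb i hib)) (single_le_iff.2 hi) hj
  have hip : i ≠ p := by rintro rfl; omega
  have hle : Pi.single i (b i) + Pi.single p (a p) ≤ d := by
    intro t
    simp only [Pi.add_apply, Pi.single_apply]
    split_ifs <;> subst_vars <;> first | contradiction | omega
  refine arrowClass_mem_of_le hβ (single_add_single_notMem_box_union hab i p)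
    (fun j hj => ?_) hle hj
  obtain hja | hjb := Finset.mem_union.1 (hab ▸ hj)
  · rw [add_comm]
    exact arrowClass_mixed_mem hβ hba hip.symm hib.le (hWb p hpa) hja
  · exact arrowClass_mixed_mem hβ hab hip hpa (hWa i hib) hjb

variable (k β a b) in
/-- A spanning family of the cotangent space at `box a ∪ box b`. In each direction it is built from
the longer of the two sides. -/
noncomputable def cotangentFamily (x : Fin r × {j : Fin r → ℕ // j ∈ β}) :
    (originIdeal k β).Cotangent :=
  if b x.1 < a x.1 then sideClass k β a b x.1 x.2 else sideClass k β b a x.1 x.2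

theorem span_range_cotangentFamily (hβ : IsBasisSet β) (hab : β = box a ∪ box b) :
    Submodule.span k (Set.range (cotangentFamily k β a b)) = ⊤ := by
  refine eq_top_of_arrowClass_mem hβ fun d hd j hj =>
    arrowClass_mem_of_sideClass_mem hβ hab (fun i hi j hj => ?_) (fun i hi j hj => ?_) hd hj
  · exact Submodule.subset_span ⟨(i, ⟨j, hj⟩), if_pos hi⟩
  · exact Submodule.subset_span ⟨(i, ⟨j, hj⟩), if_neg hi.not_gt⟩

theorem isSmoothBasisSet_box_union (k : Type*) [Field k] (b : Fin r → ℕ) (ha : ∀ i, 0 < a i) :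
    IsSmoothBasisSet k (box a ∪ box b) ∧
      Module.finrank k (originIdeal k (box a ∪ box b)).Cotangent = r * (box a ∪ box b).card := by
  have hβ := isBasisSet_box_union b ha
  have := originIdeal_isPrime (k := k) hβ
  have := finiteType_coordRing (k := k) hβ
  have : IsNoetherianRing (CoordRing k (box a ∪ box b)) :=
    Algebra.FiniteType.isNoetherianRing k _
  have hcard : Fintype.card (Fin r × {j : Fin r → ℕ // j ∈ box a ∪ box b}) =
      r * (box a ∪ box b).card := by simp
  obtain ⟨hregular, hfinrank⟩ := isRegularLocalRing_and_finrank_cotangent_eq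
    (span_range_cotangentFamily (k := k) hβ rfl)
    (by rw [hcard, mul_comm]; exact card_mul_le_height_originIdeal hβ)
  exact ⟨⟨hβ, hregular⟩, hfinrank.trans hcard⟩

end TwoBoxes

section CompoundBoxes

variable {r : ℕ}

theorem single_add_single_mem_box {w : Fin r → ℕ} {p q : Fin r} (hpq : p ≠ q)
    (hp : Pi.single p 1 ∈ box w) (hq : Pi.single q 1 ∈ box w) :
    Pi.single p 1 + Pi.single q 1 ∈ box w :=
  add_single_mem_box hp <| by simpa [hpq.symm] using mem_box.1 hq q

theorem mem_box_of_mem_image_union {β : Finset (Fin r → ℕ)} {w : Fin r → ℕ} {j : Fin r} {h : ℕ}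
    (hh : 1 ≤ h) {d : Fin r → ℕ} (hd : d ∈ β.image (fun m => Pi.single j h + m) ∪ box w)
    (hdj : d j = 0) : d ∈ box w := by
  refine (Finset.mem_union.1 hd).resolve_left fun hd => ?_
  obtain ⟨m, -, rfl⟩ := Finset.mem_image.1 hd
  simp only [Pi.add_apply, Pi.single_eq_same] at hdj
  omega

theorem not_isCompoundBox_of_forall_exists [Nonempty (Fin r)] {β : Finset (Fin r → ℕ)}
    (h : ∀ j : Fin r, ∃ p q : Fin r, p ≠ q ∧ p ≠ j ∧ q ≠ j ∧ Pi.single p 1 ∈ β ∧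
      Pi.single q 1 ∈ β ∧ Pi.single p 1 + Pi.single q 1 ∉ β) : ¬ IsCompoundBox β := by
  rintro (⟨w, -⟩ | ⟨j, β₀, _, -, n, w, hn, -, rfl⟩)
  · obtain ⟨p, q, hpq, -, -, hp, hq, hmem⟩ := h (Classical.arbitrary _)
    exact hmem (single_add_single_mem_box hpq hp hq)
  · obtain ⟨p, q, hpq, hpj, hqj, hp, hq, hmem⟩ := h j
    exact hmem <| Finset.mem_union_right _ <| single_add_single_mem_box hpq
      (mem_box_of_mem_image_union hn hp (Pi.single_eq_of_ne' hpj _))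
      (mem_box_of_mem_image_union hn hq (Pi.single_eq_of_ne' hqj _))

theorem single_one_mem_box {w : Fin r → ℕ} (hw : ∀ i, 0 < w i) {p : Fin r} (hp : 1 < w p) :
    Pi.single p 1 ∈ box w := by
  simpa using add_single_mem_box (mem_box.2 hw : (0 : Fin r → ℕ) ∈ box w) (n := 1) (by simpa)

theorem not_isCompoundBox_box_union {a b : Fin r → ℕ} (ha : ∀ i, 0 < a i) (hb : ∀ i, 0 < b i)
    (hab : {i | b i = 1 ∧ 1 < a i}.Nontrivial) (hba : {i | a i = 1 ∧ 1 < b i}.Nontrivial) :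
    ¬ IsCompoundBox (box a ∪ box b) := by
  have : Nonempty (Fin r) := ⟨hab.nonempty.some⟩
  refine not_isCompoundBox_of_forall_exists fun j => ?_
  obtain ⟨p, ⟨hbp, hap⟩, hpj⟩ := hab.exists_ne j
  obtain ⟨q, ⟨haq, hbq⟩, hqj⟩ := hba.exists_ne j
  refine ⟨p, q, by rintro rfl; omega, hpj, hqj,
    Finset.mem_union_left _ (single_one_mem_box ha hap),
    Finset.mem_union_right _ (single_one_mem_box hb hbq), ?_⟩
  have hmem := single_add_single_notMem_box_union (a := a) (b := b) rfl p q
  rwa [hbp, haq] at hmem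

theorem exists_not_isCompoundBox_box_union (hr : 4 ≤ r) :
    ∃ a b : Fin r → ℕ, (∀ i, 0 < a i) ∧ (∀ i, 0 < b i) ∧ ¬ IsCompoundBox (box a ∪ box b) := by
  have ha : ∀ i : Fin r, 0 < if i.1 < 2 then 2 else 1 := fun i => by positivity
  have hb : ∀ i : Fin r, 0 < if 2 ≤ i.1 ∧ i.1 < 4 then 2 else 1 := fun i => by positivity
  refine ⟨_, _, ha, hb, not_isCompoundBox_box_union ha hb ?_ ?_⟩
  · exact ⟨⟨0, by omega⟩, by simp, ⟨1, by omega⟩, by simp, by simp⟩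
  · exact ⟨⟨2, by omega⟩, by simp, ⟨3, by omega⟩, by simp, by simp⟩

theorem box_union_eq : box ![2, 2, 1, 1] ∪ box ![1, 1, 2, 2] =
    ({![0, 0, 0, 0], ![1, 0, 0, 0], ![0, 1, 0, 0], ![1, 1, 0, 0],
      ![0, 0, 1, 0], ![0, 0, 0, 1], ![0, 0, 1, 1]} : Finset (Fin 4 → ℕ)) := by
  decide

end CompoundBoxes

end HilbPoints

theorem mainTheorem8_general (k : Type*) [Field k] :
    (∀ (r : ℕ) (w₁ w₂ : Fin r → ℕ), (∀ i, 0 < w₁ i) →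
      HilbPoints.IsSmoothBasisSet k (HilbPoints.box w₁ ∪ HilbPoints.box w₂) ∧
      Module.finrank k
          (HilbPoints.originIdeal k (HilbPoints.box w₁ ∪ HilbPoints.box w₂)).Cotangent =
        r * (HilbPoints.box w₁ ∪ HilbPoints.box w₂).card) ∧
    (∀ r : ℕ, 4 ≤ r → ∃ w₁ w₂ : Fin r → ℕ, (∀ i, 0 < w₁ i) ∧ (∀ i, 0 < w₂ i) ∧
      ¬ HilbPoints.IsCompoundBox (HilbPoints.box w₁ ∪ HilbPoints.box w₂)) ∧
    (HilbPoints.box ![2, 2, 1, 1] ∪ HilbPoints.box ![1, 1, 2, 2] =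
        {![0, 0, 0, 0], ![1, 0, 0, 0], ![0, 1, 0, 0], ![1, 1, 0, 0],
          ![0, 0, 1, 0], ![0, 0, 0, 1], ![0, 0, 1, 1]} ∧
      ¬ HilbPoints.IsCompoundBox
        ({![0, 0, 0, 0], ![1, 0, 0, 0], ![0, 1, 0, 0], ![1, 1, 0, 0],
          ![0, 0, 1, 0], ![0, 0, 0, 1], ![0, 0, 1, 1]} : Finset (Fin 4 → ℕ))) := by
  refine ⟨fun _ _ w₂ h₁ => HilbPoints.isSmoothBasisSet_box_union k w₂ h₁,
    fun _ hr => HilbPoints.exists_not_isCompoundBox_box_union hr, HilbPoints.box_union_eq, ?_⟩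
  rw [← HilbPoints.box_union_eq]
  exact HilbPoints.not_isCompoundBox_box_union (by decide) (by decide)
    ⟨0, by simp, 1, by simp, by simp⟩ ⟨2, by simp, 3, by simp, by simp⟩

theorem mainTheorem8 (k : Type*) [Field k] [IsAlgClosed k] :
    (∀ (r : ℕ) (w₁ w₂ : Fin r → ℕ), (∀ i, 0 < w₁ i) → (∀ i, 0 < w₂ i) →
      HilbPoints.IsSmoothBasisSet k (HilbPoints.box w₁ ∪ HilbPoints.box w₂) ∧
      Module.finrank k
          (HilbPoints.originIdeal k (HilbPoints.box w₁ ∪ HilbPoints.box w₂)).Cotangent =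
        r * (HilbPoints.box w₁ ∪ HilbPoints.box w₂).card) ∧
    (∀ r : ℕ, 4 ≤ r → ∃ w₁ w₂ : Fin r → ℕ, (∀ i, 0 < w₁ i) ∧ (∀ i, 0 < w₂ i) ∧
      ¬ HilbPoints.IsCompoundBox (HilbPoints.box w₁ ∪ HilbPoints.box w₂)) ∧
    (HilbPoints.box ![2, 2, 1, 1] ∪ HilbPoints.box ![1, 1, 2, 2] =
        {![0, 0, 0, 0], ![1, 0, 0, 0], ![0, 1, 0, 0], ![1, 1, 0, 0],
          ![0, 0, 1, 0], ![0, 0, 0, 1], ![0, 0, 1, 1]} ∧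
      ¬ HilbPoints.IsCompoundBox
        ({![0, 0, 0, 0], ![1, 0, 0, 0], ![0, 1, 0, 0], ![1, 1, 0, 0],
          ![0, 0, 1, 0], ![0, 0, 0, 1], ![0, 0, 1, 1]} : Finset (Fin 4 → ℕ))) := by
  exact ⟨fun r w₁ w₂ h₁ _ => (mainTheorem8_general k).1 r w₁ w₂ h₁, (mainTheorem8_general k).2⟩
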